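/- **Exact VLC coverage probability.** Optical base stations (OBSs) form a homogeneous Poisson point process $\Phi_o$ of intensity $\lambda_o>0$ in the plane, at height $h>0$ above a typical user located at the origin. The indoor area is the disc of radius $R_m>0$ about the user, and $\mathbb P$ denotes probability conditioned on at least one OBS lying in that disc. The user is served by the nearest OBS $B_0$, at horizontal distance $r$; the other OBSs in the disc interfere. An OBS at horizontal distance $\rho$, hence at distance $u=\sqrt{\rho^2+h^2}$ and seen under the incidence and irradiance angle $\xi=\arccos(h/u)$, has channel gain $$\frac{A_{\mathrm{pd}}(m+1)}{2\pi u^2}\cos^m(\xi)\,T_f\,G(\xi)\cos(\xi),\qquad G(\xi)=\frac{n^2}{\sin^2\xi_{\mathrm{fov}}}\ \text{ for } 0\le\xi\le\xi_{\mathrm{fov}},\qquad G(\xi)=0\ \text{ for } \xi>\xi_{\mathrm{fov}},$$ and its received power is $R_{\mathrm{pd}}^2P_o$ times the square of this gain. Here $A_{\mathrm{pd}},T_f,n,R_{\mathrm{pd}},P_o>0$ (so $T_f$ is a constant filter gain), $m\ge 0$ and $0<\xi_{\mathrm{fov}}\le\pi/2$. The SINR is the power received from $B_0$ divided by the sum of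 the interfering powers and the noise power $B_of^2N_o$, with $B_o,f,N_o>0$. The SINR threshold is $\tilde\gamma=2^{R_{\mathrm{th}}/B_{\mathrm{vlc}}}-1$, with $R_{\mathrm{th}}\ge0$ and $B_{\mathrm{vlc}}>0$. Let $\mathcal T=\min(R_m,h\tan\xi_{\mathrm{fov}})$ (with $\tan(\pi/2)=\infty$), $$Z=\left(\frac{A_{\mathrm{pd}}(m+1)\,T_f\,n^2\,h^{m+1}}{2\pi\,\sin^2\xi_{\mathrm{fov}}}\right)^2,\qquad X=R_{\mathrm{pd}}^2P_oZ(r^2+h^2)^{-(m+3)},\qquad \mathcal I_a=\sum_i R_{\mathrm{pd}}^2P_oZ(\tilde r_i^2+h^2)^{-(m+3)},$$ where the sum runs over the OBSs other than $B_0$ at horizontal distance $\tilde r_i\le\mathcal T$. Put $\Omega=X-\tilde\gamma\,\mathcal I_a$ and $\phi_\Omega(\omega)=\mathbb E\left[e^{-j\omega\Omega}\,\middle|\,r\le\mathcal T\right]$. Then the coverage probability $\mathcal C_o=\mathbb P(\mathrm{SINR}>\tilde\gamma)$ satisfies $$\mathcal C_o=\left(\frac12-\frac1\pi\int_0^\infty\frac{\operatorname{Im}\left[\phi_\Omega(\omega)\,e^{\,j\tilde\gamma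 B_of^2N_o\,\omega}\right]}{\omega}\,d\omega\right)\mathbb P(r\le\mathcal T),$$ where the integrand is integrable on $(0,A]$ for every $A>0$ and $\int_0^\infty$ is the limit, which exists, of $\int_0^A$ as $A\to\infty$. -/

import Mathlib

open MeasureTheory ProbabilityTheory Set Filter Topology

noncomputable section

/-- `Φ` is a (simple) Poisson point process on `E` with intensity measure `Λ`, realised as a random
locally finite subset of `E` on the probability space `(S, P)`: the number of points in a measurable
set of finite intensity is Poisson distributed with mean the intensity of the set, and the numbers
of points in disjoint measurable sets are independent. -/
structure IsPoissonPointProcess {S E : Type*} [MeasurableSpace S] [PseudoMetricSpace E]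
    [MeasurableSpace E] (P : Measure S) (Λ : Measure E) (Φ : S → Set E) : Prop where
  locallyFinite : ∀ s (B : Set E), Bornology.IsBounded B → (Φ s ∩ B).Finite
  measurable_count : ∀ B : Set E, MeasurableSet B → Measurable fun s => (Φ s ∩ B).encard
  count_law : ∀ B : Set E, MeasurableSet B → Λ B ≠ ⊤ → ∀ k : ℕ,
    P {s | (Φ s ∩ B).encard = k} =
      ENNReal.ofReal (Real.exp (-(Λ B).toReal) * (Λ B).toReal ^ k / k.factorial)
  count_indep : ∀ (n : ℕ) (B : Fin n → Set E), (∀ i, MeasurableSet (B i)) →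
    Pairwise (fun i j => Disjoint (B i) (B j)) →
    iIndepFun (fun i s => (Φ s ∩ B i).encard) P

/-- The horizontal plane; the typical user is at the origin. A point `x` stands for an optical base
station (OBS) at horizontal position `x`, at height `h` above the receiver plane. -/
abbrev Plane : Type := EuclideanSpace ℝ (Fin 2)

/-- The parameters of the VLC network. -/
structure VLCNetwork where
  /-- intensity `λ_o` of the OBSs -/
  lam : ℝ
  /-- radius `R_m` of the indoor area, a disc around the typical user -/
  Rm : ℝ
  /-- vertical separation between OBSs and receivers -/
  h : ℝ
  /-- order of Lambertian emission -/
  m : ℝ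
  /-- detection area of the photo-detector -/
  Apd : ℝ
  /-- gain of the optical filter -/
  Tf : ℝ
  /-- refractive index `n` of the concentrator -/
  refr : ℝ
  /-- half of the field of view, `ξ_fov` -/
  fov : ℝ
  /-- optical-to-electric conversion efficiency of the receiver -/
  Rpd : ℝ
  /-- electrical transmit power `P_o` of an OBS -/
  Po : ℝ
  /-- bandwidth `B_o` -/
  Bo : ℝ
  /-- ratio `f` of average optical power to electrical signal power -/
  f : ℝ
  /-- noise power spectral density `N_o` -/
  No : ℝ
  /-- bandwidth `B_vlc` in the definition of the target SINR -/
  Bvlc : ℝ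
  /-- target rate -/
  Rth : ℝ
  lam_pos : 0 < lam
  Rm_pos : 0 < Rm
  h_pos : 0 < h
  m_nonneg : 0 ≤ m
  Apd_pos : 0 < Apd
  Tf_pos : 0 < Tf
  refr_pos : 0 < refr
  fov_pos : 0 < fov
  fov_le : fov ≤ Real.pi / 2
  Rpd_pos : 0 < Rpd
  Po_pos : 0 < Po
  Bo_pos : 0 < Bo
  f_pos : 0 < f
  No_pos : 0 < No
  Bvlc_pos : 0 < Bvlc
  Rth_nonneg : 0 ≤ Rth

namespace VLCNetwork

variable (M : VLCNetwork)

/-- Target SINR `γ̃ = 2 ^ (R_th / B_vlc) - 1`. -/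
def targetSINR : ℝ := 2 ^ (M.Rth / M.Bvlc) - 1

/-- Noise power `B_o f² N_o`. -/
def noise : ℝ := M.Bo * M.f ^ 2 * M.No

/-- Distance `u` between the typical user and the OBS at horizontal position `x`. -/
def dist3 (x : Plane) : ℝ := Real.sqrt (‖x‖ ^ 2 + M.h ^ 2)

/-- Angle of incidence `ξ` (equal to the irradiance angle `φ`) of the OBS at `x`. -/
def angle (x : Plane) : ℝ := Real.arccos (M.h / M.dist3 x)

/-- Gain `G(ξ)` of the optical concentrator; zero outside of the field of view. -/
def concentratorGain (ξ : ℝ) : ℝ :=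
  if ξ ≤ M.fov then M.refr ^ 2 / Real.sin M.fov ^ 2 else 0

/-- Lambertian channel DC gain of the OBS at `x`. -/
def channelGain (x : Plane) : ℝ :=
  M.Apd * (M.m + 1) / (2 * Real.pi * M.dist3 x ^ 2) * Real.cos (M.angle x) ^ M.m *
    M.Tf * M.concentratorGain (M.angle x) * Real.cos (M.angle x)

/-- Electrical power `R_pd² P_o P_i` received from the OBS at `x`, with `P_i` the squared gain. -/
def receivedPower (x : Plane) : ℝ := M.Rpd ^ 2 * M.Po * M.channelGain x ^ 2

/-- The OBSs in the indoor area, out of a planar configuration `C`. -/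
def indoor (C : Set Plane) : Set Plane := C ∩ Metric.closedBall 0 M.Rm

open Classical in
/-- The serving OBS `B₀`: a nearest point of the configuration to the origin (`0` if there is none,
as for the empty configuration). -/
def serving (C : Set Plane) : Plane :=
  if hC : ∃ x ∈ C, ∀ y ∈ C, ‖x‖ ≤ ‖y‖ then hC.choose else 0

/-- Horizontal distance `r` between the typical user and its serving OBS. -/
def servingDist (C : Set Plane) : ℝ := ‖serving (M.indoor C)‖

/-- The SINR of the typical user: the serving OBS is the nearest one, all the other OBSs of the
indoor area are interferers. -/
def sinr (C : Set Plane) : ℝ :=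
  M.receivedPower (serving (M.indoor C)) /
    ((∑ᶠ x ∈ M.indoor C \ {serving (M.indoor C)}, M.receivedPower x) + M.noise)

/-- `𝒯 = min (R_m, h tan ξ_fov)`, where `tan (π / 2) = ∞`. -/
def fovRadius : ℝ := if M.fov < Real.pi / 2 then min M.Rm (M.h * Real.tan M.fov) else M.Rm

/-- The constant `Z`. -/
def Z : ℝ :=
  (M.Apd * (M.m + 1) * M.Tf * (M.refr ^ 2 / Real.sin M.fov ^ 2) * M.h ^ (M.m + 1) /
    (2 * Real.pi)) ^ 2

/-- The power `R_pd² P_o Z (r² + h²)^(-(m + 3))` as a function of the horizontal distance. -/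
def powerAt (r : ℝ) : ℝ := M.Rpd ^ 2 * M.Po * M.Z * (r ^ 2 + M.h ^ 2) ^ (-(M.m + 3))

/-- Aggregate interference `I_a` from the OBSs in the field of view other than the serving one. -/
def interference (C : Set Plane) : ℝ :=
  ∑ᶠ x ∈ (C ∩ Metric.closedBall 0 M.fovRadius) \ {serving (M.indoor C)}, M.powerAt ‖x‖

/-- `Ω = X - γ̃ I_a`, where `X` is the power of the serving OBS. -/
def omegaVar (C : Set Plane) : ℝ :=
  M.powerAt (M.servingDist C) - M.targetSINR * M.interference C

variable {S : Type*} [MeasurableSpace S] (P : Measure S) (Φ : S → Set Plane)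

/-- The probability measure `ℙ` of the model: there is at least one OBS in the indoor area. -/
def prob : Measure S := P[|{s | (M.indoor (Φ s)).Nonempty}]

/-- The coverage probability `C_o`: the probability that the SINR exceeds its target. -/
def coverageProb : ℝ := (M.prob P Φ).real {s | M.targetSINR < M.sinr (Φ s)}

/-- `ℙ(r ≤ 𝒯)`. -/
def probInFov : ℝ := (M.prob P Φ).real {s | M.servingDist (Φ s) ≤ M.fovRadius}

/-- The characteristic function `φ_Ω(w) = 𝔼[exp(-j w Ω)]`, given that the serving OBS is in the
field of view. -/
def charFunOmega (w : ℝ) : ℂ :=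
  ∫ s, Complex.exp (-(Complex.I * w * M.omegaVar (Φ s)))
    ∂((M.prob P Φ)[|{s | M.servingDist (Φ s) ≤ M.fovRadius}])

/-- The integrand `Im[φ_Ω(w) exp(j w γ̃ B_o f² N_o)] / w` of the inversion formula. -/
def inversionIntegrand (w : ℝ) : ℝ :=
  (M.charFunOmega P Φ w * Complex.exp (Complex.I * w * (M.targetSINR * M.noise : ℝ))).im / w

end VLCNetwork

end

/-! ### The Dirichlet integral. -/

noncomputable section

/-! An OBS outside the field of view delivers no power and one inside delivers exactly the power
law, so coverage means `r ≤ 𝒯` and `Ω > γ̃ B_o f² N_o` (`targetSINR_lt_sinr_iff`). The rest is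
Gil-Pelaez inversion for `Y = γ̃ B_o f² N_o - Ω` under the law conditioned on `r ≤ 𝒯`.

The integrand is `𝔼[sin(wY)]/w = 𝔼[Y sinc(wY)]`, continuous in `w` because `Y` is integrable: a
Poisson count has finite mean and each power is bounded. Fubini turns its integral over `(0, A]`
into `𝔼[Si(AY)]`, where `Si` is the primitive of `sinc` vanishing at 0. As `Si` is bounded with
limits `±π/2`, dominated convergence gives `π/2 (ℙ(Y > 0) - ℙ(Y < 0))`
(`tendsto_integral_integral_mul_sinc`).

To conclude, `Y = 0` must have probability zero, so `Ω` must have no atoms (`ae_max_sub_finsum_ne`).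
Almost surely no two powers coincide, so some rational `q` separates the strongest power from the
others. For fixed `q`, the points of power above `q` and those of power at most `q` lie in disjoint
regions, hence are independent; a lone point of the first region hits a value determined by the
second with probability zero, since circles have zero area. Small partitions of the line make this
quantitative, using only the counts that define the process. -/

theorem integral_exp_mul_sin_eq_sinc {w : ℝ} (hw : 0 < w) :
    ∫ t in Ioi (0 : ℝ), Real.exp (-(w * t)) * Real.sin w = Real.sinc w := by
  have h := integral_exp_mul_Ioi (a := -w) (by linarith) 0
  rw [integral_mul_const, Real.sinc_of_ne_zero hw.ne']
  simp only [neg_mul, mul_zero, Real.exp_zero] at h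
  rw [h]
  field_simp

theorem hasDerivAt_exp_mul_sin_primitive (t w : ℝ) :
    HasDerivAt (fun w => -(Real.exp (-(w * t)) * (Real.cos w + t * Real.sin w)) / (1 + t ^ 2))
      (Real.exp (-(w * t)) * Real.sin w) w := by
  have h1 : HasDerivAt (fun w => Real.exp (-(w * t))) (Real.exp (-(w * t)) * (-(1 * t))) w :=
    (((hasDerivAt_id w).mul_const t).neg).exp
  have h2 : HasDerivAt (fun w => Real.cos w + t * Real.sin w)
      (-Real.sin w + t * Real.cos w) w :=
    (Real.hasDerivAt_cos w).add ((Real.hasDerivAt_sin w).const_mul t)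
  refine (((h1.mul h2).neg).div_const (1 + t ^ 2)).congr_deriv ?_
  have : (1 + t ^ 2) ≠ 0 := by positivity
  field_simp
  ring

theorem integral_exp_mul_sin (t A : ℝ) :
    ∫ w in (0 : ℝ)..A, Real.exp (-(w * t)) * Real.sin w =
      (1 + t ^ 2)⁻¹ - Real.exp (-(A * t)) * (Real.cos A + t * Real.sin A) * (1 + t ^ 2)⁻¹ := by
  rw [intervalIntegral.integral_eq_sub_of_hasDerivAt
    (fun w _ => hasDerivAt_exp_mul_sin_primitive t w)
    (Continuous.intervalIntegrable (by fun_prop) _ _)]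
  simp
  ring

/-- Integrating the absolute value in `t` first leaves `|sinc w| ≤ 1`, which is integrable because
`A` is finite. -/
theorem integrable_exp_mul_sin_prod (A : ℝ) :
    Integrable (Function.uncurry fun w t : ℝ => Real.exp (-(w * t)) * Real.sin w)
      ((volume.restrict (Ioc 0 A)).prod (volume.restrict (Ioi 0))) := by
  have hm : AEStronglyMeasurable
      (Function.uncurry fun w t : ℝ => Real.exp (-(w * t)) * Real.sin w)
      ((volume.restrict (Ioc 0 A)).prod (volume.restrict (Ioi 0))) := by
    apply Continuous.aestronglyMeasurable
    unfold Function.uncurry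
    fun_prop
  rw [integrable_prod_iff hm]
  constructor
  · filter_upwards [ae_restrict_mem measurableSet_Ioc] with w hw
    have := (integrableOn_exp_mul_Ioi (a := -w) (by linarith [hw.1]) 0).mul_const (Real.sin w)
    simpa [Function.uncurry, IntegrableOn] using this
  · refine Integrable.mono' (g := fun _ => (1 : ℝ)) (integrable_const _)
      hm.norm.integral_prod_right' ?_
    filter_upwards [ae_restrict_mem measurableSet_Ioc] with w hw
    have h1 : (∫ t in Ioi (0 : ℝ), ‖Real.exp (-(w * t)) * Real.sin w‖) = |Real.sinc w| := by
      rw [← integral_exp_mul_sin_eq_sinc hw.1, integral_mul_const, abs_mul,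
        abs_of_nonneg (integral_nonneg fun _ => (Real.exp_pos _).le), ← integral_mul_const]
      simp
    simp only [Function.uncurry]
    rw [h1, Real.norm_eq_abs, abs_abs]
    exact Real.abs_sinc_le_one w

/-- Fubini after writing `1/w` as a Laplace integral: the `w`-integral becomes elementary, its
constant part gives `π/2` through the arctangent, and the remainder carries a factor `exp(-At)`. -/
theorem integral_sinc_eq {A : ℝ} (hA : 0 ≤ A) :
    ∫ w in (0 : ℝ)..A, Real.sinc w = Real.pi / 2 -
      ∫ t in Ioi (0 : ℝ),
        Real.exp (-(A * t)) * (Real.cos A + t * Real.sin A) * (1 + t ^ 2)⁻¹ := by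
  have hi := integrable_exp_mul_sin_prod A
  have h1 : ∫ w in (0 : ℝ)..A, Real.sinc w =
      ∫ w in Ioc (0 : ℝ) A, ∫ t in Ioi (0 : ℝ), Real.exp (-(w * t)) * Real.sin w := by
    rw [intervalIntegral.integral_of_le hA]
    exact setIntegral_congr_fun measurableSet_Ioc
      fun w hw => (integral_exp_mul_sin_eq_sinc hw.1).symm
  have h2 : Integrable (fun t : ℝ => (1 + t ^ 2)⁻¹ -
      Real.exp (-(A * t)) * (Real.cos A + t * Real.sin A) * (1 + t ^ 2)⁻¹)
      (volume.restrict (Ioi 0)) := by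
    refine hi.integral_prod_right.congr (Eventually.of_forall fun t => ?_)
    simp only [Function.uncurry]
    rw [← integral_exp_mul_sin, intervalIntegral.integral_of_le hA]
  have h3 : Integrable (fun t : ℝ => (1 + t ^ 2)⁻¹) (volume.restrict (Ioi 0)) :=
    integrable_inv_one_add_sq.integrableOn
  have h4 : Integrable (fun t : ℝ =>
      Real.exp (-(A * t)) * (Real.cos A + t * Real.sin A) * (1 + t ^ 2)⁻¹)
      (volume.restrict (Ioi 0)) :=
    (h3.sub h2).congr (Eventually.of_forall fun t => by simp)
  rw [h1, integral_integral_swap hi]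
  have h5 := integral_Ioi_inv_one_add_sq (i := 0)
  rw [Real.arctan_zero, sub_zero] at h5
  rw [← h5, ← integral_sub h3 h4]
  refine integral_congr_ae (Eventually.of_forall fun t => ?_)
  simp only
  rw [← integral_exp_mul_sin, intervalIntegral.integral_of_le hA]

/-- The Dirichlet integral. -/
theorem tendsto_integral_sinc :
    Tendsto (fun A : ℝ => ∫ w in (0 : ℝ)..A, Real.sinc w) atTop (𝓝 (Real.pi / 2)) := by
  have h : Tendsto (fun A : ℝ => ∫ t in Ioi (0 : ℝ),
      Real.exp (-(A * t)) * (Real.cos A + t * Real.sin A) * (1 + t ^ 2)⁻¹) atTop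
      (𝓝 (∫ _ in Ioi (0 : ℝ), (0 : ℝ))) := by
    refine tendsto_integral_filter_of_dominated_convergence (fun t => (1 + t ^ 2)⁻¹)
      (Eventually.of_forall fun A => ?_) ?_ integrable_inv_one_add_sq.integrableOn ?_
    · apply Measurable.aestronglyMeasurable
      fun_prop
    · filter_upwards [eventually_ge_atTop 1] with A hA
      filter_upwards [ae_restrict_mem measurableSet_Ioi] with t ht
      have ht : 0 < t := ht
      rw [norm_mul, norm_mul, Real.norm_eq_abs, Real.norm_eq_abs, Real.norm_eq_abs,
        abs_of_pos (Real.exp_pos _), abs_of_nonneg (a := (1 + t ^ 2)⁻¹) (by positivity)]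
      have h1 : |Real.cos A + t * Real.sin A| ≤ t + 1 := by
        have e1 := Real.abs_cos_le_one A
        have e2 := Real.abs_sin_le_one A
        calc _ ≤ |Real.cos A| + |t * Real.sin A| := abs_add_le _ _
          _ ≤ 1 + t * 1 := by rw [abs_mul, abs_of_pos ht]; gcongr
          _ = _ := by ring
      have h2 : Real.exp (-(A * t)) ≤ Real.exp (-t) := Real.exp_le_exp.2 (by nlinarith)
      -- For `A ≥ 1` the bound `1 + t ≤ exp t` absorbs the linear growth, leaving the dominating
      -- function `1/(1 + t²)`.
      have h3 : Real.exp (-(A * t)) * |Real.cos A + t * Real.sin A| ≤ 1 :=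
        calc _ ≤ Real.exp (-t) * Real.exp t :=
              mul_le_mul h2 (h1.trans (Real.add_one_le_exp t)) (abs_nonneg _) (Real.exp_pos _).le
          _ = 1 := by rw [← Real.exp_add]; simp
      exact mul_le_of_le_one_left (by positivity) h3
    · filter_upwards [ae_restrict_mem measurableSet_Ioi] with t ht
      have ht : 0 < t := ht
      have h0 : Tendsto (fun A : ℝ => Real.exp (-(A * t))) atTop (𝓝 0) :=
        Real.tendsto_exp_neg_atTop_nhds_zero.comp (tendsto_id.atTop_mul_const ht)
      have h1 : Tendsto (fun A : ℝ => Real.exp (-(A * t)) * (Real.cos A + t * Real.sin A))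
          atTop (𝓝 0) := by
        refine squeeze_zero_norm (a := fun A => Real.exp (-(A * t)) * (1 + t)) (fun A => ?_) ?_
        · rw [norm_mul, Real.norm_eq_abs, abs_of_pos (Real.exp_pos _)]
          gcongr
          have e1 := Real.abs_cos_le_one A
          have e2 := Real.abs_sin_le_one A
          calc _ ≤ |Real.cos A| + |t * Real.sin A| := abs_add_le _ _
            _ ≤ 1 + t * 1 := by rw [abs_mul, abs_of_pos ht]; gcongr
            _ = _ := by ring
        · simpa using h0.mul_const (1 + t)
      simpa using h1.mul_const _
  rw [integral_zero] at h
  have h' := (tendsto_const_nhds (x := Real.pi / 2)).sub h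
  rw [sub_zero] at h'
  refine h'.congr' ?_
  filter_upwards [eventually_ge_atTop 0] with A hA
  exact (integral_sinc_eq hA).symm

theorem continuous_integral_sinc : Continuous fun A : ℝ => ∫ w in (0 : ℝ)..A, Real.sinc w :=
  intervalIntegral.continuous_primitive
    (fun _ _ => Real.continuous_sinc.intervalIntegrable _ _) 0

theorem integral_sinc_neg (A : ℝ) :
    ∫ w in (0 : ℝ)..(-A), Real.sinc w = -∫ w in (0 : ℝ)..A, Real.sinc w := by
  have h := intervalIntegral.integral_comp_neg (a := A) (b := 0) Real.sinc
  simp only [Real.sinc_neg, neg_zero] at h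
  rw [← h, intervalIntegral.integral_symm]

/-- Convergence controls large `A`, compactness the remaining `A ≥ 0`, oddness the negative ones.
This constant dominates in the inversion limit. -/
theorem exists_abs_integral_sinc_le :
    ∃ C : ℝ, ∀ A : ℝ, |∫ w in (0 : ℝ)..A, Real.sinc w| ≤ C := by
  obtain ⟨B, hB⟩ := eventually_atTop.1
    (tendsto_integral_sinc.abs.eventually (gt_mem_nhds (lt_add_one _)))
  obtain ⟨D, hD⟩ := isCompact_Icc.exists_bound_of_continuousOn (s := Icc 0 B)
    continuous_integral_sinc.continuousOn
  have key : ∀ A : ℝ, 0 ≤ A →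
      |∫ w in (0 : ℝ)..A, Real.sinc w| ≤ max (|Real.pi / 2| + 1) D := fun A hA => by
    rcases le_total B A with h | h
    · exact (hB A h).le.trans (le_max_left _ _)
    · exact (hD A ⟨hA, h⟩).trans (le_max_right _ _)
  refine ⟨max (|Real.pi / 2| + 1) D, fun A => ?_⟩
  rcases le_total 0 A with h | h
  · exact key A h
  · have := key (-A) (by linarith)
    rwa [integral_sinc_neg, abs_neg] at this

/-! ### Gil-Pelaez inversion. -/

section Inversion

variable {S : Type*} [MeasurableSpace S] {Q : Measure S}

/-- Writing `sin(wY)/w` as `Y sinc(wY)` removes the singularity at `w = 0` and leaves `|Y|` as a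
dominating function. -/
theorem continuous_integral_mul_sinc {Y : S → ℝ} (hY : Integrable Y Q) :
    Continuous fun w : ℝ => ∫ s, Y s * Real.sinc (w * Y s) ∂Q := by
  refine continuous_of_dominated (bound := fun s => |Y s|) (fun w => ?_) (fun w => ?_)
    hY.abs ?_
  · exact hY.aestronglyMeasurable.mul
      (Real.continuous_sinc.comp_aestronglyMeasurable (hY.aestronglyMeasurable.const_mul w))
  · refine Eventually.of_forall fun s => ?_
    rw [norm_mul]
    exact mul_le_of_le_one_right (norm_nonneg _) (Real.abs_sinc_le_one _)
  · exact Eventually.of_forall fun s =>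
      continuous_const.mul (Real.continuous_sinc.comp (continuous_id.mul continuous_const))

theorem integral_integral_mul_sinc [IsFiniteMeasure Q] {Y : S → ℝ} (hY : Integrable Y Q)
    (A : ℝ) :
    ∫ w in (0 : ℝ)..A, ∫ s, Y s * Real.sinc (w * Y s) ∂Q =
      ∫ s, (∫ w in (0 : ℝ)..(A * Y s), Real.sinc w) ∂Q := by
  rw [intervalIntegral_integral_swap]
  · refine integral_congr_ae (Eventually.of_forall fun s => ?_)
    simp only
    rw [intervalIntegral.integral_const_mul, intervalIntegral.mul_integral_comp_mul_right,
      zero_mul]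
  · have : IsFiniteMeasure ((volume : Measure ℝ).restrict (uIoc 0 A)) := by
      rw [uIoc]
      infer_instance
    have hm : AEStronglyMeasurable (fun p : ℝ × S => Y p.2)
        ((volume.restrict (uIoc 0 A)).prod Q) := hY.aestronglyMeasurable.comp_snd
    refine Integrable.mono' (g := fun p => |Y p.2|) ?_ ?_ ?_
    · exact hY.abs.comp_snd _
    · exact hm.mul (Real.continuous_sinc.comp_aestronglyMeasurable
        (measurable_fst.aestronglyMeasurable.mul hm))
    · refine Eventually.of_forall fun p => ?_
      simp only [Function.uncurry]
      rw [norm_mul]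
      exact mul_le_of_le_one_right (norm_nonneg _) (Real.abs_sinc_le_one _)

/-- The Gil-Pelaez inversion limit for an integrable random variable. -/
theorem tendsto_integral_integral_mul_sinc [IsFiniteMeasure Q] {Y : S → ℝ}
    (hY : Integrable Y Q) (hYm : Measurable Y) :
    Tendsto (fun A : ℝ => ∫ w in (0 : ℝ)..A, ∫ s, Y s * Real.sinc (w * Y s) ∂Q) atTop
      (𝓝 (Real.pi / 2 * (Q.real {s | 0 < Y s} - Q.real {s | Y s < 0}))) := by
  simp only [integral_integral_mul_sinc hY]
  have hlim : Real.pi / 2 * (Q.real {s | 0 < Y s} - Q.real {s | Y s < 0}) =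
      ∫ s, (Real.pi / 2 * ({s | 0 < Y s}.indicator 1 s - {s | Y s < 0}.indicator 1 s)) ∂Q := by
    have m1 : MeasurableSet {s | 0 < Y s} := measurableSet_lt measurable_const hYm
    have m2 : MeasurableSet {s | Y s < 0} := measurableSet_lt hYm measurable_const
    rw [integral_const_mul, integral_sub, integral_indicator_one m1, integral_indicator_one m2]
    · exact (integrable_const (1 : ℝ)).indicator m1
    · exact (integrable_const (1 : ℝ)).indicator m2
  rw [hlim]
  obtain ⟨C, hC⟩ := exists_abs_integral_sinc_le
  refine tendsto_integral_filter_of_dominated_convergence (fun _ => C)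
    (Eventually.of_forall fun A => ?_) (Eventually.of_forall fun A =>
      Eventually.of_forall fun s => hC _) (integrable_const _) (Eventually.of_forall fun s => ?_)
  · exact continuous_integral_sinc.comp_aestronglyMeasurable
      (hY.aestronglyMeasurable.const_mul A)
  · rcases lt_trichotomy (Y s) 0 with h | h | h
    · have h1 := (tendsto_integral_sinc.comp
        (tendsto_id.atTop_mul_const (neg_pos.2 h))).neg
      have e : Real.pi / 2 * ({s | 0 < Y s}.indicator 1 s - {s | Y s < 0}.indicator 1 s) =
          -(Real.pi / 2) := by
        simp [indicator, h, h.not_gt]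
      rw [e]
      refine h1.congr fun A => ?_
      simp only [Function.comp, id]
      rw [mul_neg, integral_sinc_neg, neg_neg]
    · simp [h]
    · have h1 := tendsto_integral_sinc.comp (tendsto_id.atTop_mul_const h)
      have e : Real.pi / 2 * ({s | 0 < Y s}.indicator 1 s - {s | Y s < 0}.indicator 1 s) =
          Real.pi / 2 := by
        simp [indicator, h, h.not_gt]
      rw [e]
      exact h1

end Inversion

end

/-! ### Poisson processes: sums over points, independence, count estimates. -/

noncomputable section

/-- Grouping points by value expresses the sum through finitely many counts, the only data the
definition of the process controls. -/
theorem finsum_mem_simpleFunc_eq_sum_encard {E : Type*} [MeasurableSpace E] {C : Set E}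
    (hC : C.Finite) (f : SimpleFunc E ℝ) :
    ∑ᶠ x ∈ C, f x = ∑ v ∈ f.range, ((C ∩ f ⁻¹' {v}).encard.toNat : ℝ) * v := by
  classical
  rw [finsum_mem_eq_finite_toFinset_sum _ hC,
    ← Finset.sum_fiberwise_of_maps_to (s := hC.toFinset) (t := f.range) (g := f)
      (fun x _ => f.mem_range_self x)]
  refine Finset.sum_congr rfl fun v _ => ?_
  rw [Finset.sum_congr rfl (g := fun _ => v) (fun x hx => (Finset.mem_filter.1 hx).2),
    Finset.sum_const, nsmul_eq_mul]
  congr 2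
  have : C ∩ f ⁻¹' {v} = ((hC.toFinset.filter fun x => f x = v : Finset E) : Set E) := by
    ext x
    simp
  rw [this, Set.encard_coe_eq_coe_finsetCard, ENat.toNat_natCast]

theorem tendsto_finsum_mem_of_finite {E : Type*} {C : Set E} (hC : C.Finite) {f : ℕ → E → ℝ}
    {g : E → ℝ} (h : ∀ x, Tendsto (fun n => f n x) atTop (𝓝 (g x))) :
    Tendsto (fun n => ∑ᶠ x ∈ C, f n x) atTop (𝓝 (∑ᶠ x ∈ C, g x)) := by
  simp only [finsum_mem_eq_finite_toFinset_sum _ hC]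
  exact tendsto_finsetSum _ fun x _ => h x

namespace IsPoissonPointProcess

variable {S E : Type*} [MeasurableSpace S] [PseudoMetricSpace E] [MeasurableSpace E]
  {P : Measure S} {Λ : Measure E} {Φ : S → Set E}

theorem measurable_toNat_count (hΦ : IsPoissonPointProcess P Λ Φ) {B : Set E}
    (hB : MeasurableSet B) : Measurable fun s => (Φ s ∩ B).encard.toNat :=
  (Measurable.of_discrete (f := ENat.toNat)).comp (hΦ.measurable_count B hB)

theorem measurable_finsum (hΦ : IsPoissonPointProcess P Λ Φ) {B : Set E} (hB : MeasurableSet B)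
    (hBb : Bornology.IsBounded B) {f : E → ℝ} (hf : Measurable f) :
    Measurable fun s => ∑ᶠ x ∈ Φ s ∩ B, f x := by
  refine measurable_of_tendsto_metrizable
    (f := fun n s => ∑ᶠ x ∈ Φ s ∩ B, hf.stronglyMeasurable.approx n x) (fun n => ?_)
    (tendsto_pi_nhds.2 fun s => tendsto_finsum_mem_of_finite (hΦ.locallyFinite s B hBb)
      hf.stronglyMeasurable.tendsto_approx)
  simp only [finsum_mem_simpleFunc_eq_sum_encard (hΦ.locallyFinite _ B hBb), inter_assoc]
  refine Finset.measurable_sum _ fun v _ => Measurable.mul_const ?_ _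
  exact measurable_from_top.comp (hΦ.measurable_toNat_count
    (hB.inter (SimpleFunc.measurableSet_fiber _ v)))

theorem iIndepFun_count (hΦ : IsPoissonPointProcess P Λ Φ) {ι : Type*} [Fintype ι]
    {B : ι → Set E} (hB : ∀ i, MeasurableSet (B i))
    (hd : Pairwise fun i j => Disjoint (B i) (B j)) :
    iIndepFun (fun i s => (Φ s ∩ B i).encard) P := by
  let e := Fintype.equivFin ι
  have h := hΦ.count_indep (Fintype.card ι) (fun i => B (e.symm i)) (fun i => hB _)
    (fun i j hij => hd (e.symm.injective.ne hij))
  have h' := h.precomp e.injective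
  simpa using h'

/-- The set `A` (index `none`) and the level sets of `f` in `B` form one finite disjoint family with
independent counts; each side is a function of its own block. -/
theorem indepFun_count_finsum_simpleFunc (hΦ : IsPoissonPointProcess P Λ Φ) {A B : Set E}
    (hA : MeasurableSet A) (hB : MeasurableSet B) (hAB : Disjoint A B)
    (hBb : Bornology.IsBounded B) (f : SimpleFunc E ℝ) :
    IndepFun (fun s => (Φ s ∩ A).encard.toNat) (fun s => ∑ᶠ x ∈ Φ s ∩ B, f x) P := by
  classical
  let D : Option f.range → Set E := fun o => o.elim A fun v => B ∩ f ⁻¹' {v.1}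
  have hD : ∀ o, MeasurableSet (D o) := by
    rintro (_ | v)
    · exact hA
    · exact hB.inter (SimpleFunc.measurableSet_fiber _ _)
  have hdis : Pairwise fun i j => Disjoint (D i) (D j) := by
    rintro (_ | v) (_ | w) hvw
    · exact absurd rfl hvw
    · exact hAB.mono_right inter_subset_left
    · exact (hAB.mono_right inter_subset_left).symm
    · refine Set.disjoint_left.2 fun x hx hx' => hvw ?_
      have h1 : f x = v.1 := hx.2
      have h2 : f x = w.1 := hx'.2
      rw [Option.some_inj, Subtype.ext_iff, ← h1, h2]
  have hi := (hΦ.iIndepFun_count hD hdis).indepFun_finset {none}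
    (Finset.univ.image some) (by simp) fun o => hΦ.measurable_count _ (hD o)
  have hm : ∀ v : f.range, some v ∈ (Finset.univ.image some : Finset (Option f.range)) :=
    fun v => Finset.mem_image_of_mem _ (Finset.mem_univ v)
  have h2 := hi.comp (φ := fun c => (c ⟨none, Finset.mem_singleton_self _⟩).toNat)
    (ψ := fun c => ∑ v : f.range, ((c ⟨some v, hm v⟩).toNat : ℝ) * v.1)
    ((Measurable.of_discrete (f := ENat.toNat)).comp (measurable_pi_apply _))
    (Finset.measurable_sum _ fun v _ => Measurable.mul_const
      ((Measurable.of_discrete (f := fun k : ℕ∞ => (k.toNat : ℝ))).comp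
        (measurable_pi_apply _)) _)
  refine h2.congr (Eventually.of_forall fun s => rfl) (Eventually.of_forall fun s => ?_)
  simp only [Function.comp]
  rw [finsum_mem_simpleFunc_eq_sum_encard (hΦ.locallyFinite _ B hBb), Finset.univ_eq_attach,
    ← Finset.sum_attach f.range]
  simp only [inter_assoc]
  rfl

/-- Bounded continuous test functions detect independence, and their product formula passes from
simple approximations to the limit by dominated convergence. -/
theorem indepFun_count_finsum [IsProbabilityMeasure P] (hΦ : IsPoissonPointProcess P Λ Φ)
    {A B : Set E} (hA : MeasurableSet A) (hB : MeasurableSet B) (hAB : Disjoint A B)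
    (hBb : Bornology.IsBounded B) {f : E → ℝ} (hf : Measurable f) :
    IndepFun (fun s => (Φ s ∩ A).encard.toNat) (fun s => ∑ᶠ x ∈ Φ s ∩ B, f x) P := by
  have hZ := hΦ.measurable_toNat_count hA
  refine indepFun_of_bcf hZ.aemeasurable
    (hΦ.measurable_finsum hB hBb hf).aemeasurable fun u v => ?_
  let F := fun n => hf.stronglyMeasurable.approx n
  have hlim : ∀ s, Tendsto (fun n => v (∑ᶠ x ∈ Φ s ∩ B, F n x)) atTop
      (𝓝 (v (∑ᶠ x ∈ Φ s ∩ B, f x))) := fun s =>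
    (v.continuous.tendsto _).comp (tendsto_finsum_mem_of_finite (hΦ.locallyFinite s B hBb)
      hf.stronglyMeasurable.tendsto_approx)
  have hmn : ∀ n, Measurable fun s => v (∑ᶠ x ∈ Φ s ∩ B, F n x) := fun n =>
    v.continuous.measurable.comp (hΦ.measurable_finsum hB hBb (F n).measurable)
  have hmu : Measurable fun s => u ((Φ s ∩ A).encard.toNat) :=
    u.continuous.measurable.comp hZ
  have h1 : Tendsto (fun n => ∫ s, u ((Φ s ∩ A).encard.toNat) * v (∑ᶠ x ∈ Φ s ∩ B, F n x) ∂P)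
      atTop (𝓝 (∫ s, u ((Φ s ∩ A).encard.toNat) * v (∑ᶠ x ∈ Φ s ∩ B, f x) ∂P)) := by
    refine tendsto_integral_of_dominated_convergence (fun _ => ‖u‖ * ‖v‖)
      (fun n => (hmu.mul (hmn n)).aestronglyMeasurable) (integrable_const _)
      (fun n => Eventually.of_forall fun s => ?_)
      (Eventually.of_forall fun s => (hlim s).const_mul _)
    rw [norm_mul]
    exact mul_le_mul (u.norm_coe_le_norm _) (v.norm_coe_le_norm _) (norm_nonneg _) (norm_nonneg _)
  have h2 : Tendsto (fun n => ∫ s, v (∑ᶠ x ∈ Φ s ∩ B, F n x) ∂P)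
      atTop (𝓝 (∫ s, v (∑ᶠ x ∈ Φ s ∩ B, f x) ∂P)) :=
    tendsto_integral_of_dominated_convergence (fun _ => ‖v‖)
      (fun n => (hmn n).aestronglyMeasurable) (integrable_const _)
      (fun n => Eventually.of_forall fun s => v.norm_coe_le_norm _)
      (Eventually.of_forall hlim)
  refine tendsto_nhds_unique h1 ((h2.const_mul _).congr fun n => ?_)
  have hi := (hΦ.indepFun_count_finsum_simpleFunc hA hB hAB hBb (F n)).comp
    u.continuous.measurable v.continuous.measurable
  exact (hi.integral_fun_mul_eq_mul_integral hmu.aestronglyMeasurable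
    (hmn n).aestronglyMeasurable).symm

theorem measurableSet_count (hΦ : IsPoissonPointProcess P Λ Φ) {B : Set E}
    (hB : MeasurableSet B) (K : Set ℕ∞) : MeasurableSet {s | (Φ s ∩ B).encard ∈ K} :=
  hΦ.measurable_count B hB (MeasurableSet.of_discrete (s := K))

theorem measureReal_count_eq (hΦ : IsPoissonPointProcess P Λ Φ) {B : Set E}
    (hB : MeasurableSet B) (hΛ : Λ B ≠ ⊤) (k : ℕ) :
    P.real {s | (Φ s ∩ B).encard = k} =
      Real.exp (-(Λ B).toReal) * (Λ B).toReal ^ k / k.factorial := by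
  rw [measureReal_def, hΦ.count_law B hB hΛ k, ENNReal.toReal_ofReal (by positivity)]

theorem measureReal_nonempty [IsProbabilityMeasure P] (hΦ : IsPoissonPointProcess P Λ Φ)
    {B : Set E} (hB : MeasurableSet B) (hΛ : Λ B ≠ ⊤) :
    P.real {s | (Φ s ∩ B).Nonempty} = 1 - Real.exp (-(Λ B).toReal) := by
  have h := hΦ.measureReal_count_eq hB hΛ 0
  have e : {s | (Φ s ∩ B).Nonempty} = {s | (Φ s ∩ B).encard = (0 : ℕ)}ᶜ := by
    ext s
    simp [nonempty_iff_ne_empty]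
  have m0 : MeasurableSet {s | (Φ s ∩ B).encard = (0 : ℕ)} :=
    hΦ.measurableSet_count hB {((0 : ℕ) : ℕ∞)}
  rw [e, measureReal_compl m0, h]
  simp

theorem measureReal_nonempty_le [IsProbabilityMeasure P] (hΦ : IsPoissonPointProcess P Λ Φ)
    {B : Set E} (hB : MeasurableSet B) (hΛ : Λ B ≠ ⊤) :
    P.real {s | (Φ s ∩ B).Nonempty} ≤ (Λ B).toReal := by
  rw [hΦ.measureReal_nonempty hB hΛ]
  linarith [Real.add_one_le_exp (-(Λ B).toReal)]

/-- With mean `x`, `(1 + x) exp(-x) ≥ (1 + x)(1 - x)`. The quadratic order makes two points in one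
cell negligible under refinement. -/
theorem measureReal_one_lt_count_le [IsProbabilityMeasure P] (hΦ : IsPoissonPointProcess P Λ Φ)
    {B : Set E} (hB : MeasurableSet B) (hΛ : Λ B ≠ ⊤) :
    P.real {s | 1 < (Φ s ∩ B).encard} ≤ (Λ B).toReal ^ 2 := by
  have h0 := hΦ.measureReal_count_eq hB hΛ 0
  have h1 := hΦ.measureReal_count_eq hB hΛ 1
  have e : {s | 1 < (Φ s ∩ B).encard} =
      ({s | (Φ s ∩ B).encard = (0 : ℕ)} ∪ {s | (Φ s ∩ B).encard = (1 : ℕ)})ᶜ := by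
    ext s
    simp only [mem_ofPred_eq, mem_compl_iff, mem_union, Nat.cast_zero, Nat.cast_one]
    rw [← not_le, Order.le_one_iff]
  have m0 : MeasurableSet {s | (Φ s ∩ B).encard = (0 : ℕ)} :=
    hΦ.measurableSet_count hB {((0 : ℕ) : ℕ∞)}
  have m1 : MeasurableSet {s | (Φ s ∩ B).encard = (1 : ℕ)} :=
    hΦ.measurableSet_count hB {((1 : ℕ) : ℕ∞)}
  rw [e, measureReal_compl (m0.union m1), measureReal_union _ m1, h0, h1]
  · have hx : 0 ≤ (Λ B).toReal := ENNReal.toReal_nonneg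
    have := Real.add_one_le_exp (-(Λ B).toReal)
    simp
    nlinarith
  · refine Set.disjoint_left.2 fun s hs hs' => ?_
    simp only [mem_ofPred_eq] at hs hs'
    rw [hs] at hs'
    simp at hs'

theorem integrable_toNat_count (hΦ : IsPoissonPointProcess P Λ Φ) {B : Set E}
    (hB : MeasurableSet B) (hBb : Bornology.IsBounded B) (hΛ : Λ B ≠ ⊤) :
    Integrable (fun s => ((Φ s ∩ B).encard.toNat : ℝ)) P := by
  have hm := hΦ.measurable_toNat_count hB
  have hmap : P.map (fun s => (Φ s ∩ B).encard.toNat) = poissonMeasure (Λ B).toNNReal := by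
    refine Measure.ext_of_singleton fun k => ?_
    rw [Measure.map_apply hm (measurableSet_singleton k), poissonMeasure_singleton]
    have e : (fun s => (Φ s ∩ B).encard.toNat) ⁻¹' {k} = {s | (Φ s ∩ B).encard = k} := by
      ext s
      have := (hΦ.locallyFinite s B hBb).encard_lt_top.ne
      simp only [mem_preimage, mem_singleton_iff, mem_ofPred_eq]
      rw [← ENat.natCast_inj, ENat.natCast_toNat this]
    rw [e, hΦ.count_law B hB hΛ k]
    rfl
  have h : Integrable (fun k : ℕ => (k : ℝ)) (P.map (fun s => (Φ s ∩ B).encard.toNat)) := by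
    rw [hmap, integrable_poissonMeasure_iff]
    set r : ℝ := ((Λ B).toNNReal : ℝ)
    -- The shift lets the factor `k + 1` cancel against `(k + 1)!`, leaving the exponential series.
    rw [← summable_nat_add_iff 1]
    refine ((Real.summable_pow_div_factorial r).mul_left (Real.exp (-r) * r)).congr fun k => ?_
    rw [Nat.factorial_succ, Real.norm_of_nonneg (by positivity)]
    push_cast
    field_simp
    ring
  exact h.comp_measurable hm

end IsPoissonPointProcess

end

/-! ### Absence of ties and atoms. -/

noncomputable section

open scoped ENNReal

/-- A finite Borel measure on the line without atoms admits countable measurable partitions into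
sets of arbitrarily small measure. -/
theorem exists_measurable_partition_measure_le (μ : Measure ℝ)
    [IsFiniteMeasure μ] [NullSingletonClass μ]
    {ε : ℝ≥0∞} (hε : 0 < ε) :
    ∃ J : ℕ → Set ℝ, (∀ k, MeasurableSet (J k)) ∧ Pairwise (Function.onFun Disjoint J) ∧
      ⋃ k, J k = univ ∧ ∀ k, μ (J k) ≤ ε := by
  have h : ∀ x : ℝ, ∃ U : Set ℝ, {x} ⊆ U ∧ IsOpen U ∧ μ U < ε := fun x => by
    have := Set.exists_isOpen_lt_of_lt {x} ε (μ := μ) (by simpa using hε)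
    obtain ⟨U, h1, h2, h3⟩ := this
    exact ⟨U, h1, h2, h3⟩
  choose U hxU hUo hUμ using h
  -- Outer regularity gives each null point a small neighbourhood; Lindelöf extracts a countable
  -- cover, later made disjoint.
  obtain ⟨t, ht, hcov⟩ := TopologicalSpace.countable_cover_nhds
    (f := U) fun x => (hUo x).mem_nhds (hxU x rfl)
  have hne : t.Nonempty := by
    by_contra hne
    rw [not_nonempty_iff_eq_empty] at hne
    simp [hne] at hcov
    exact absurd hcov.symm univ_nonempty.ne_empty
  obtain ⟨e, rfl⟩ := ht.exists_eq_range hne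
  refine ⟨disjointed fun k => U (e k), fun k => ?_, disjoint_disjointed _, ?_, fun k => ?_⟩
  · exact MeasurableSet.disjointed (fun i => (hUo _).measurableSet) k
  · rw [iUnion_disjointed, ← hcov, biUnion_range]
  · exact (measure_mono (disjointed_subset _ k)).trans (hUμ _).le

/-- Null level sets make the image of `Λ.restrict A` under `f` atomless, so a partition of the line
pulls back. -/
theorem exists_partition_of_null_fibers {E : Type*} [MeasurableSpace E] {Λ : Measure E} {A : Set E}
    (hΛ : Λ A ≠ ∞) {f : E → ℝ} (hf : Measurable f) (hnull : ∀ v, Λ (A ∩ f ⁻¹' {v}) = 0) {ε : ℝ≥0∞}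
    (hε : 0 < ε) :
    ∃ J : ℕ → Set ℝ, (∀ k, MeasurableSet (J k)) ∧ Pairwise (Function.onFun Disjoint J) ∧
      ⋃ k, J k = univ ∧ ∀ k, Λ (A ∩ f ⁻¹' J k) ≤ ε := by
  have happ : ∀ J, MeasurableSet J → (Λ.restrict A).map f J = Λ (A ∩ f ⁻¹' J) := fun J hJ => by
    rw [Measure.map_apply hf hJ, Measure.restrict_apply (hf hJ), inter_comm]
  have : IsFiniteMeasure (Λ.restrict A) := ⟨by simpa using hΛ.lt_top⟩
  have : NullSingletonClass ((Λ.restrict A).map f) :=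
    ⟨fun v => by rw [happ _ (measurableSet_singleton v), hnull]⟩
  obtain ⟨J, h1, h2, h3, h4⟩ := exists_measurable_partition_measure_le ((Λ.restrict A).map f) hε
  exact ⟨J, h1, h2, h3, fun k => by rw [← happ _ (h1 k)]; exact h4 k⟩

namespace IsPoissonPointProcess

variable {S E : Type*} [MeasurableSpace S] [PseudoMetricSpace E] [MeasurableSpace E]
  {P : Measure S} {Λ : Measure E} {Φ : S → Set E}

theorem measure_nonempty_le [IsProbabilityMeasure P] (hΦ : IsPoissonPointProcess P Λ Φ)
    {B : Set E} (hB : MeasurableSet B) (hΛ : Λ B ≠ ∞) :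
    P {s | (Φ s ∩ B).Nonempty} ≤ Λ B := by
  rw [← ENNReal.toReal_le_toReal (measure_ne_top _ _) hΛ]
  exact hΦ.measureReal_nonempty_le hB hΛ

theorem measure_one_lt_count_le [IsProbabilityMeasure P] (hΦ : IsPoissonPointProcess P Λ Φ)
    {B : Set E} (hB : MeasurableSet B) (hΛ : Λ B ≠ ∞) :
    P {s | 1 < (Φ s ∩ B).encard} ≤ Λ B ^ 2 := by
  rw [← ENNReal.toReal_le_toReal (measure_ne_top _ _) (ENNReal.pow_ne_top hΛ), ENNReal.toReal_pow]
  exact hΦ.measureReal_one_lt_count_le hB hΛ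

/-- If the level sets of `f` are null, then almost surely no two points of the process have the
same value under `f`. -/
theorem ae_injOn [IsProbabilityMeasure P] (hΦ : IsPoissonPointProcess P Λ Φ) {A : Set E}
    (hA : MeasurableSet A) (hΛ : Λ A ≠ ∞) {f : E → ℝ} (hf : Measurable f)
    (hnull : ∀ v, Λ (A ∩ f ⁻¹' {v}) = 0) : ∀ᵐ s ∂P, InjOn f (Φ s ∩ A) := by
  have key : ∀ ε : ℝ≥0∞, 0 < ε → P {s | ¬ InjOn f (Φ s ∩ A)} ≤ ε * Λ A := fun ε hε => by
    obtain ⟨J, hJm, hJd, hJu, hJε⟩ := exists_partition_of_null_fibers hΛ hf hnull hε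
    have hm : ∀ k, MeasurableSet (A ∩ f ⁻¹' J k) := fun k => hA.inter (hf (hJm k))
    have hfin : ∀ k, Λ (A ∩ f ⁻¹' J k) ≠ ∞ := fun k =>
      ((measure_mono inter_subset_left).trans_lt hΛ.lt_top).ne
    calc P {s | ¬ InjOn f (Φ s ∩ A)}
        ≤ P (⋃ k, {s | 1 < (Φ s ∩ (A ∩ f ⁻¹' J k)).encard}) := by
          refine measure_mono fun s hs => ?_
          simp only [mem_ofPred_eq, InjOn, not_forall] at hs
          obtain ⟨x, hx, y, hy, hxy, hne⟩ := hs
          obtain ⟨k, hk⟩ := mem_iUnion.1 (hJu.symm ▸ mem_univ (f x) : f x ∈ ⋃ k, J k)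
          refine mem_iUnion.2 ⟨k, ?_⟩
          exact Set.one_lt_encard_iff.2
            ⟨x, y, ⟨hx.1, hx.2, hk⟩, ⟨hy.1, hy.2, by rwa [mem_preimage, ← hxy]⟩, hne⟩
      _ ≤ ∑' k, P {s | 1 < (Φ s ∩ (A ∩ f ⁻¹' J k)).encard} := measure_iUnion_le _
      -- One factor of `Λ(cell)²` is at most `ε`; the other sums to `Λ A`.
      _ ≤ ∑' k, ε * Λ (A ∩ f ⁻¹' J k) := by
          refine ENNReal.tsum_le_tsum fun k => (hΦ.measure_one_lt_count_le (hm k) (hfin k)).trans ?_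
          rw [sq]
          gcongr
          exact hJε k
      _ = ε * Λ A := by
          rw [ENNReal.tsum_mul_left, ← measure_iUnion (fun i j hij =>
            ((hJd hij).preimage f).mono inter_subset_right inter_subset_right) hm,
            ← inter_iUnion, ← preimage_iUnion, hJu, preimage_univ, inter_univ]
  have h0 : Tendsto (fun ε : ℝ≥0∞ => ε * Λ A) (𝓝[>] 0) (𝓝 0) := by
    have := ENNReal.Tendsto.mul_const (b := Λ A) (tendsto_id (α := ℝ≥0∞) (x := 𝓝 0))
      (Or.inr hΛ)
    rw [zero_mul] at this
    exact this.mono_left nhdsWithin_le_nhds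
  exact nonpos_iff_eq_zero.1 (ge_of_tendsto h0 (eventually_mem_nhdsWithin.mono key))

/-- If the level sets of `f` are null, then the value of `f` at the only point of the process in
`A` almost surely differs from any affine function of the sum of `f` over the points in a set `D`
disjoint from `A`. -/
theorem ae_value_ne_affine_finsum [IsProbabilityMeasure P] (hΦ : IsPoissonPointProcess P Λ Φ)
    {A D : Set E} (hA : MeasurableSet A) (hΛ : Λ A ≠ ∞) (hD : MeasurableSet D)
    (hAD : Disjoint A D) (hDb : Bornology.IsBounded D) {f : E → ℝ} (hf : Measurable f)
    (hnull : ∀ v, Λ (A ∩ f ⁻¹' {v}) = 0) (a c : ℝ) :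
    ∀ᵐ s ∂P, ∀ x, Φ s ∩ A = {x} → f x ≠ c + a * ∑ᶠ y ∈ Φ s ∩ D, f y := by
  set Y : S → ℝ := fun s => c + a * ∑ᶠ y ∈ Φ s ∩ D, f y
  have hYm : Measurable Y :=
    ((hΦ.measurable_finsum hD hDb hf).const_mul a).const_add c
  have key : ∀ ε : ℝ≥0∞, 0 < ε → P {s | ¬ ∀ x, Φ s ∩ A = {x} → f x ≠ Y s} ≤ ε := fun ε hε => by
    obtain ⟨J, hJm, hJd, hJu, hJε⟩ := exists_partition_of_null_fibers hΛ hf hnull hε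
    have hm : ∀ k, MeasurableSet (A ∩ f ⁻¹' J k) := fun k => hA.inter (hf (hJm k))
    have hfin : ∀ k, Λ (A ∩ f ⁻¹' J k) ≠ ∞ := fun k =>
      ((measure_mono inter_subset_left).trans_lt hΛ.lt_top).ne
    have hone : ∀ k, P {s | (Φ s ∩ (A ∩ f ⁻¹' J k)).encard.toNat = 1} ≤ ε := fun k => by
      refine (measure_mono fun s hs => ?_).trans
        ((hΦ.measure_nonempty_le (hm k) (hfin k)).trans (hJε k))
      by_contra hemp
      have hemp : Φ s ∩ (A ∩ f ⁻¹' J k) = ∅ := not_nonempty_iff_eq_empty.1 hemp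
      simp [hemp] at hs
    calc P {s | ¬ ∀ x, Φ s ∩ A = {x} → f x ≠ Y s}
        ≤ P (⋃ k, {s | (Φ s ∩ (A ∩ f ⁻¹' J k)).encard.toNat = 1} ∩ Y ⁻¹' J k) := by
          refine measure_mono fun s hs => ?_
          simp only [mem_ofPred_eq, not_forall, not_not] at hs
          obtain ⟨x, hx, hxY⟩ := hs
          obtain ⟨k, hk⟩ := mem_iUnion.1 (hJu.symm ▸ mem_univ (f x) : f x ∈ ⋃ k, J k)
          refine mem_iUnion.2 ⟨k, ?_, by rwa [mem_preimage, ← hxY]⟩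
          have : Φ s ∩ (A ∩ f ⁻¹' J k) = {x} := by
            rw [← inter_assoc, hx]
            exact inter_eq_left.2 (singleton_subset_iff.2 hk)
          simp [this]
      _ ≤ ∑' k, P ({s | (Φ s ∩ (A ∩ f ⁻¹' J k)).encard.toNat = 1} ∩ Y ⁻¹' J k) :=
          measure_iUnion_le _
      -- Independence splits each term. The first factor is at most `ε`, and the events `Y ∈ J k`
      -- partition the sample space, so the total is `ε`.
      _ ≤ ∑' k, ε * P (Y ⁻¹' J k) := by
          refine ENNReal.tsum_le_tsum fun k => ?_
          have hi := (hΦ.indepFun_count_finsum (hm k) hD (hAD.mono_left inter_subset_left)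
            hDb hf).comp (φ := id) (ψ := fun z => c + a * z) measurable_id (by fun_prop)
          have := hi.measure_inter_preimage_eq_mul {1} (J k) (measurableSet_singleton 1) (hJm k)
          refine (le_of_eq this).trans ?_
          gcongr
          · exact hone k
          · exact le_rfl
      _ = ε := by
          rw [ENNReal.tsum_mul_left, ← measure_iUnion (fun i j hij => (hJd hij).preimage Y)
            (fun k => hYm (hJm k)), ← preimage_iUnion, hJu, preimage_univ, measure_univ, mul_one]
  have h0 : Tendsto (fun ε : ℝ≥0∞ => ε) (𝓝[>] 0) (𝓝 0) := nhdsWithin_le_nhds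
  exact nonpos_iff_eq_zero.1 (ge_of_tendsto h0 (eventually_mem_nhdsWithin.mono key))

/-- If the level sets of `f` are null, then the largest value of `f` on the process, minus a
multiple of the sum of the other values, has no atoms. -/
theorem ae_max_sub_finsum_ne [IsProbabilityMeasure P] (hΦ : IsPoissonPointProcess P Λ Φ)
    {B : Set E} (hB : MeasurableSet B) (hBb : Bornology.IsBounded B) (hΛ : Λ B ≠ ∞)
    {f : E → ℝ} (hf : Measurable f) (hnull : ∀ v, Λ (B ∩ f ⁻¹' {v}) = 0) (a c : ℝ) :
    ∀ᵐ s ∂P, ∀ x ∈ Φ s ∩ B, (∀ y ∈ Φ s ∩ B, f y ≤ f x) →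
      f x - a * ∑ᶠ y ∈ (Φ s ∩ B) \ {x}, f y ≠ c := by
  -- Rational thresholds keep the exceptional set null while allowing `q` to depend on the
  -- configuration.
  have h2 : ∀ᵐ s ∂P, ∀ q : ℚ, ∀ x, Φ s ∩ (B ∩ f ⁻¹' Ioi (q : ℝ)) = {x} →
      f x ≠ c + a * ∑ᶠ y ∈ Φ s ∩ (B ∩ f ⁻¹' Iic (q : ℝ)), f y := by
    refine ae_all_iff.2 fun q => hΦ.ae_value_ne_affine_finsum
      (hB.inter (hf measurableSet_Ioi)) ((measure_mono inter_subset_left).trans_lt hΛ.lt_top).ne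
      (hB.inter (hf measurableSet_Iic)) ?_ (hBb.subset inter_subset_left) hf (fun v => ?_) a c
    · refine Set.disjoint_left.2 fun x hx hx' => ?_
      exact absurd (show f x ≤ q from hx'.2) (not_le.2 hx.2)
    · exact measure_mono_null (inter_subset_inter_left _ inter_subset_left) (hnull v)
  filter_upwards [hΦ.ae_injOn hB hΛ hf hnull, h2] with s hinj hs x hx hmax heq
  have hfinite : ((Φ s ∩ B) \ {x}).Finite := (hΦ.locallyFinite s B hBb).sdiff
  have hlt : ∀ y ∈ (Φ s ∩ B) \ {x}, f y < f x := fun y hy =>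
    lt_of_le_of_ne (hmax y hy.1) fun h => hy.2 (hinj hy.1 hx h)
  obtain ⟨q, hq1, hq2⟩ : ∃ q : ℚ, (∀ y ∈ (Φ s ∩ B) \ {x}, f y ≤ q) ∧ (q : ℝ) < f x := by
    rcases ((Φ s ∩ B) \ {x}).eq_empty_or_nonempty with h | h
    · obtain ⟨q, hq⟩ := exists_rat_lt (f x)
      exact ⟨q, by simp [h], hq⟩
    · obtain ⟨z, hz, hzmax⟩ := Set.exists_max_image _ f hfinite h
      obtain ⟨q, hq1, hq2⟩ := exists_rat_btwn (hlt z hz)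
      exact ⟨q, fun y hy => (hzmax y hy).trans hq1.le, hq2⟩
  have e1 : Φ s ∩ (B ∩ f ⁻¹' Ioi (q : ℝ)) = {x} := by
    ext y
    refine ⟨fun hy => ?_, fun hy => ?_⟩
    · by_contra hne
      exact absurd (hq1 y ⟨⟨hy.1, hy.2.1⟩, hne⟩) (not_le.2 hy.2.2)
    · rw [mem_singleton_iff.1 hy]
      exact ⟨hx.1, hx.2, hq2⟩
  have e2 : Φ s ∩ (B ∩ f ⁻¹' Iic (q : ℝ)) = (Φ s ∩ B) \ {x} := by
    ext y
    refine ⟨fun hy => ⟨⟨hy.1, hy.2.1⟩, fun hyx => ?_⟩, fun hy => ⟨hy.1.1, hy.1.2, hq1 y hy⟩⟩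
    rw [mem_singleton_iff.1 hyx] at hy
    exact absurd (show f x ≤ q from hy.2.2) (not_le.2 hq2)
  refine hs q x e1 ?_
  rw [e2, ← heq]
  ring

end IsPoissonPointProcess

end

/-! ### Geometry of the network: from SINR to `Ω`. -/

noncomputable section

namespace VLCNetwork

theorem serving_spec {C : Set Plane} (hC : C.Finite) (hne : C.Nonempty) :
    serving C ∈ C ∧ ∀ y ∈ C, ‖serving C‖ ≤ ‖y‖ := by
  have h : ∃ x ∈ C, ∀ y ∈ C, ‖x‖ ≤ ‖y‖ := Set.exists_min_image C (fun x => ‖x‖) hC hne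
  rw [serving, dif_pos h]
  exact h.choose_spec

theorem serving_empty : serving ∅ = 0 := by
  simp [serving]

variable (M : VLCNetwork)

theorem sin_fov_pos : 0 < Real.sin M.fov :=
  Real.sin_pos_of_pos_of_lt_pi M.fov_pos (by linarith [M.fov_le, Real.pi_pos])

theorem fovRadius_pos : 0 < M.fovRadius := by
  unfold fovRadius
  split_ifs with h
  · exact lt_min M.Rm_pos (mul_pos M.h_pos (Real.tan_pos_of_pos_of_lt_pi_div_two M.fov_pos h))
  · exact M.Rm_pos

theorem fovRadius_le_Rm : M.fovRadius ≤ M.Rm := by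
  unfold fovRadius
  split_ifs with h
  · exact min_le_left _ _
  · exact le_rfl

theorem targetSINR_nonneg : 0 ≤ M.targetSINR := by
  have := Real.one_le_rpow (x := 2) (by norm_num) (div_nonneg M.Rth_nonneg M.Bvlc_pos.le)
  unfold targetSINR
  linarith

theorem noise_pos : 0 < M.noise :=
  mul_pos (mul_pos M.Bo_pos (pow_pos M.f_pos 2)) M.No_pos

theorem Z_pos : 0 < M.Z := by
  have := M.Apd_pos
  have := M.m_nonneg
  have := M.Tf_pos
  have := M.refr_pos
  have := M.sin_fov_pos
  have := M.h_pos
  have := Real.pi_pos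
  unfold Z
  positivity

theorem powerAt_pos (r : ℝ) : 0 < M.powerAt r := by
  have := M.Rpd_pos
  have := M.Po_pos
  have := M.Z_pos
  have := M.h_pos
  unfold powerAt
  positivity

theorem powerAt_strictAnti {r t : ℝ} (hr : 0 ≤ r) (hrt : r < t) :
    M.powerAt t < M.powerAt r := by
  have := M.Rpd_pos
  have := M.Po_pos
  have := M.Z_pos
  have := M.h_pos
  have := M.m_nonneg
  unfold powerAt
  refine mul_lt_mul_of_pos_left ?_ (by positivity)
  exact Real.rpow_lt_rpow_of_neg (by positivity) (by nlinarith) (by linarith)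

theorem powerAt_anti {r t : ℝ} (hr : 0 ≤ r) (hrt : r ≤ t) : M.powerAt t ≤ M.powerAt r := by
  rcases hrt.eq_or_lt with rfl | h
  · exact le_rfl
  · exact (M.powerAt_strictAnti hr h).le

theorem measurable_powerAt : Measurable M.powerAt := by
  unfold powerAt
  fun_prop

theorem dist3_pos (x : Plane) : 0 < M.dist3 x :=
  Real.sqrt_pos.2 (by have := M.h_pos; positivity)

theorem dist3_sq (x : Plane) : M.dist3 x ^ 2 = ‖x‖ ^ 2 + M.h ^ 2 :=
  Real.sq_sqrt (by positivity)

theorem div_dist3_le_one (x : Plane) : M.h / M.dist3 x ≤ 1 := by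
  rw [div_le_one (M.dist3_pos x)]
  exact Real.le_sqrt_of_sq_le (by nlinarith [sq_nonneg ‖x‖])

theorem cos_angle (x : Plane) : Real.cos (M.angle x) = M.h / M.dist3 x :=
  Real.cos_arccos (by linarith [div_pos M.h_pos (M.dist3_pos x)]) (M.div_dist3_le_one x)

/-- Below `π/2`, comparing cosines and squaring gives `‖x‖ cos ξ_fov ≤ h sin ξ_fov`. At `π/2` every
OBS is visible, since `h/u > 0`. -/
theorem angle_le_fov_iff (x : Plane) (hx : ‖x‖ ≤ M.Rm) :
    M.angle x ≤ M.fov ↔ ‖x‖ ≤ M.fovRadius := by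
  have hd := M.dist3_pos x
  have hh := M.h_pos
  have hsq := M.dist3_sq x
  rcases M.fov_le.lt_or_eq with h | h
  · have hcos : 0 < Real.cos M.fov :=
      Real.cos_pos_of_mem_Ioo ⟨by linarith [M.fov_pos, Real.pi_pos], h⟩
    have hsin := M.sin_fov_pos
    have e1 : M.angle x ≤ M.fov ↔ Real.cos M.fov ≤ M.h / M.dist3 x := by
      rw [← M.cos_angle x]
      exact (Real.strictAntiOn_cos.le_iff_ge
        ⟨M.fov_pos.le, by linarith [Real.pi_pos]⟩
        ⟨Real.arccos_nonneg _, Real.arccos_le_pi _⟩).symm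
    rw [e1, le_div_iff₀ hd, fovRadius, if_pos h, le_min_iff, Real.tan_eq_sin_div_cos,
      ← mul_div_assoc, le_div_iff₀ hcos,
      ← sq_le_sq₀ (mul_pos hcos hd).le hh.le,
      ← sq_le_sq₀ (mul_nonneg (norm_nonneg x) hcos.le) (mul_pos hh hsin).le]
    have hcs := Real.sin_sq_add_cos_sq M.fov
    have : Real.sin M.fov ^ 2 = 1 - Real.cos M.fov ^ 2 := by linarith
    rw [mul_pow, mul_pow, mul_pow, hsq, this]
    constructor
    · intro h; exact ⟨hx, by nlinarith⟩
    · rintro ⟨-, h⟩; nlinarith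
  · have h1 : M.angle x ≤ M.fov := by
      rw [h]
      exact Real.arccos_le_pi_div_two.2 (div_pos hh hd).le
    rw [fovRadius, if_neg (by linarith)]
    exact ⟨fun _ => hx, fun _ => h1⟩

/-- With `cos ξ = h/u`, the gain is proportional to `h^(m+1) / u^(m+3)`. -/
theorem receivedPower_of_le (x : Plane) (hx : ‖x‖ ≤ M.fovRadius) :
    M.receivedPower x = M.powerAt ‖x‖ := by
  have h1 := (M.angle_le_fov_iff x (hx.trans M.fovRadius_le_Rm)).2 hx
  have hd := M.dist3_pos x
  have hh := M.h_pos
  have hs := M.sin_fov_pos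
  have hpi := Real.pi_pos
  rw [receivedPower, powerAt, channelGain, concentratorGain, if_pos h1, M.cos_angle, Z,
    ← M.dist3_sq, mul_assoc (M.Rpd ^ 2 * M.Po)]
  congr 1
  have e1 : (M.dist3 x ^ 2) ^ (-(M.m + 3)) = ((M.dist3 x ^ M.m * M.dist3 x ^ 3) ^ 2)⁻¹ := by
    rw [Real.rpow_neg (by positivity), ← Real.rpow_natCast (M.dist3 x) 3, ← Real.rpow_add hd,
      ← Real.rpow_natCast (M.dist3 x) 2, ← Real.rpow_natCast _ 2, ← Real.rpow_mul hd.le,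
      ← Real.rpow_mul hd.le]
    congr 2
    push_cast
    ring
  rw [e1, Real.div_rpow hh.le hd.le, Real.rpow_add hh, Real.rpow_one]
  have : 0 < M.dist3 x ^ M.m := Real.rpow_pos_of_pos hd _
  field_simp

theorem receivedPower_of_lt (x : Plane) (hx : ‖x‖ ≤ M.Rm) (hx' : M.fovRadius < ‖x‖) :
    M.receivedPower x = 0 := by
  have h1 := mt (M.angle_le_fov_iff x hx).1 (not_le.2 hx')
  simp [receivedPower, channelGain, concentratorGain, h1]

theorem indoor_inter_fov (C : Set Plane) :
    M.indoor C ∩ Metric.closedBall 0 M.fovRadius = C ∩ Metric.closedBall 0 M.fovRadius := by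
  rw [indoor, inter_assoc,
    inter_eq_right.2 (Metric.closedBall_subset_closedBall M.fovRadius_le_Rm)]

theorem finsum_receivedPower (C : Set Plane) :
    ∑ᶠ x ∈ M.indoor C \ {serving (M.indoor C)}, M.receivedPower x = M.interference C := by
  rw [interference]
  have hnorm : ∀ x ∈ M.indoor C, ‖x‖ ≤ M.Rm := fun x hx => by simpa using hx.2
  refine (finsum_mem_inter_support_eq' _ _ _ fun x hx => ?_).trans
    (finsum_mem_congr rfl fun x hx => M.receivedPower_of_le x (by simpa using hx.1.2))
  constructor
  · rintro ⟨h1, h2⟩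
    refine ⟨⟨h1.1, ?_⟩, h2⟩
    by_contra hlt
    refine hx (M.receivedPower_of_lt x (hnorm x h1) ?_)
    simpa using hlt
  · rintro ⟨h1, h2⟩
    rw [← M.indoor_inter_fov] at h1
    exact ⟨h1.1, h2⟩

theorem interference_nonneg (C : Set Plane) : 0 ≤ M.interference C :=
  finsum_nonneg fun _ => finsum_nonneg fun _ => (M.powerAt_pos _).le

/-- A user is covered if and only if its serving OBS is in the field of view and `Ω` exceeds the
scaled noise power. -/
theorem targetSINR_lt_sinr_iff {C : Set Plane} (hC : (M.indoor C).Finite)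
    (hne : (M.indoor C).Nonempty) :
    M.targetSINR < M.sinr C ↔
      M.servingDist C ≤ M.fovRadius ∧ M.targetSINR * M.noise < M.omegaVar C := by
  have hpos : 0 < M.interference C + M.noise :=
    add_pos_of_nonneg_of_pos (M.interference_nonneg C) M.noise_pos
  rw [sinr, finsum_receivedPower, lt_div_iff₀ hpos, omegaVar]
  rcases le_or_gt (M.servingDist C) M.fovRadius with h | h
  · rw [M.receivedPower_of_le _ h, ← servingDist]
    simp only [h, true_and]
    constructor <;> intro h' <;> nlinarith
  · have hle : ‖serving (M.indoor C)‖ ≤ M.Rm := by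
      simpa using (serving_spec hC hne).1.2
    rw [M.receivedPower_of_lt _ hle h]
    -- A zero signal cannot strictly exceed a nonnegative threshold.
    have := mul_nonneg M.targetSINR_nonneg hpos.le
    simp [h.not_ge, this]

theorem serving_mem_fov {C : Set Plane} (hC : (M.indoor C).Finite) (hne : (M.indoor C).Nonempty)
    (hr : M.servingDist C ≤ M.fovRadius) :
    serving (M.indoor C) ∈ C ∩ Metric.closedBall 0 M.fovRadius :=
  ⟨(serving_spec hC hne).1.1, by simpa [servingDist] using hr⟩

/-- Adding the serving power to the interference removes the chosen point from the sum. Only its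
distance and a sum over a fixed disc remain, both measurable. -/
theorem omegaVar_eq {C : Set Plane} (hC : (M.indoor C).Finite) (hne : (M.indoor C).Nonempty)
    (hr : M.servingDist C ≤ M.fovRadius) :
    M.omegaVar C = (1 + M.targetSINR) * M.powerAt (M.servingDist C) -
      M.targetSINR * ∑ᶠ x ∈ C ∩ Metric.closedBall 0 M.fovRadius, M.powerAt ‖x‖ := by
  have hmem := M.serving_mem_fov hC hne hr
  have hfin : (C ∩ Metric.closedBall 0 M.fovRadius).Finite := by
    rw [← M.indoor_inter_fov]
    exact hC.inter_of_left _
  have h : ∑ᶠ x ∈ C ∩ Metric.closedBall 0 M.fovRadius, M.powerAt ‖x‖ =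
      M.powerAt (M.servingDist C) + M.interference C := by
    conv_lhs => rw [← insert_sdiff_self_of_mem hmem]
    rw [finsum_mem_insert _ (by simp) hfin.sdiff]
    rfl
  rw [h, omegaVar]
  ring

end VLCNetwork

end

/-! ### The network driven by the Poisson process. -/

noncomputable section

open scoped ENNReal

theorem integrable_cond {S : Type*} [MeasurableSpace S] {P : Measure S} {s : Set S}
    (hs : P s ≠ 0) {f : S → ℝ} (hf : Integrable f P) : Integrable f P[|s] :=
  hf.restrict.smul_measure (ENNReal.inv_ne_top.2 hs)

namespace VLCNetwork

variable (M : VLCNetwork) {S : Type*} [MeasurableSpace S] {P : Measure S} {Φ : S → Set Plane}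

theorem intensity_closedBall_ne_top (r : ℝ) :
    (ENNReal.ofReal M.lam • (volume : Measure Plane)) (Metric.closedBall 0 r) ≠ ∞ := by
  rw [Measure.smul_apply, smul_eq_mul]
  exact ENNReal.mul_ne_top ENNReal.ofReal_ne_top measure_closedBall_lt_top.ne

theorem intensity_closedBall_pos {r : ℝ} (hr : 0 < r) :
    0 < (ENNReal.ofReal M.lam • (volume : Measure Plane)) (Metric.closedBall 0 r) := by
  rw [Measure.smul_apply, smul_eq_mul]
  exact ENNReal.mul_pos (ENNReal.ofReal_pos.2 M.lam_pos).ne'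
    (Metric.measure_closedBall_pos _ _ hr).ne'

/-- Power is strictly decreasing in distance, so a level set lies in a circle. -/
theorem powerAt_norm_fiber_null (B : Set Plane) (v : ℝ) :
    (ENNReal.ofReal M.lam • (volume : Measure Plane))
      (B ∩ (fun x => M.powerAt ‖x‖) ⁻¹' {v}) = 0 := by
  rw [Measure.smul_apply, smul_eq_mul]
  by_cases h : ∃ x : Plane, M.powerAt ‖x‖ = v
  · obtain ⟨x, rfl⟩ := h
    refine mul_eq_zero_of_right _ (measure_mono_null (t := Metric.sphere 0 ‖x‖) ?_
      (Measure.addHaar_sphere volume _ _))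
    rintro y ⟨-, hy⟩
    have hy : M.powerAt ‖y‖ = M.powerAt ‖x‖ := hy
    rw [mem_sphere_zero_iff_norm]
    rcases lt_trichotomy ‖y‖ ‖x‖ with h | h | h
    · exact absurd hy (M.powerAt_strictAnti (norm_nonneg _) h).ne'
    · exact h
    · exact absurd hy (M.powerAt_strictAnti (norm_nonneg _) h).ne
  · have : (fun x : Plane => M.powerAt ‖x‖) ⁻¹' {v} = ∅ :=
      eq_empty_of_forall_notMem fun x hx => h ⟨x, hx⟩
    simp [this]

theorem finite_indoor
    (hΦ : IsPoissonPointProcess P (ENNReal.ofReal M.lam • (volume : Measure Plane)) Φ) (s : S) :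
    (M.indoor (Φ s)).Finite :=
  hΦ.locallyFinite s _ Metric.isBounded_closedBall

theorem measurableSet_inter_closedBall_nonempty
    (hΦ : IsPoissonPointProcess P (ENNReal.ofReal M.lam • (volume : Measure Plane)) Φ) (r : ℝ) :
    MeasurableSet {s | (Φ s ∩ Metric.closedBall 0 r).Nonempty} := by
  have h := hΦ.measurableSet_count (Metric.isClosed_closedBall (x := 0) (ε := r)).measurableSet
    {0}ᶜ
  convert h using 2
  ext s
  simp [nonempty_iff_ne_empty]

theorem measurable_servingDist
    (hΦ : IsPoissonPointProcess P (ENNReal.ofReal M.lam • (volume : Measure Plane)) Φ) :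
    Measurable fun s => M.servingDist (Φ s) := by
  refine measurable_of_Iic fun t => ?_
  rcases lt_or_ge t 0 with ht | ht
  · convert MeasurableSet.empty
    refine eq_empty_of_forall_notMem fun s hs => ?_
    have h0 : 0 ≤ M.servingDist (Φ s) := norm_nonneg _
    have h1 : M.servingDist (Φ s) ≤ t := hs
    linarith
  -- An empty indoor area contributes to every `t ≥ 0`, because `serving` then defaults to the
  -- origin.
  · have e : (fun s => M.servingDist (Φ s)) ⁻¹' Iic t =
        {s | (Φ s ∩ Metric.closedBall 0 M.Rm).Nonempty}ᶜ ∪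
          {s | (Φ s ∩ Metric.closedBall 0 (min t M.Rm)).Nonempty} := by
      ext s
      have hfin := M.finite_indoor hΦ s
      simp only [mem_preimage, mem_Iic, mem_union, mem_compl_iff, mem_ofPred_eq]
      rcases (M.indoor (Φ s)).eq_empty_or_nonempty with hemp | hne
      · have h0 : M.servingDist (Φ s) = 0 := by
          rw [servingDist, hemp, serving_empty, norm_zero]
        have h1 : ¬ (Φ s ∩ Metric.closedBall 0 M.Rm).Nonempty :=
          not_nonempty_iff_eq_empty.2 hemp
        simp [h0, ht, h1]
      · have h1 : (Φ s ∩ Metric.closedBall 0 M.Rm).Nonempty := hne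
        obtain ⟨hmem, hmin⟩ := serving_spec hfin hne
        have hRm : ‖serving (M.indoor (Φ s))‖ ≤ M.Rm := by simpa using hmem.2
        simp only [h1, not_true_eq_false, false_or]
        constructor
        · intro h
          exact ⟨_, hmem.1, by simpa using ⟨h, hRm⟩⟩
        · rintro ⟨y, hy, hyt⟩
          have hyt : ‖y‖ ≤ t ∧ ‖y‖ ≤ M.Rm := by simpa using hyt
          exact (hmin y ⟨hy, by simpa using hyt.2⟩).trans hyt.1
    rw [e]
    exact (M.measurableSet_inter_closedBall_nonempty hΦ _).compl.union
      (M.measurableSet_inter_closedBall_nonempty hΦ _)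

theorem integrable_finsum_powerAt
    (hΦ : IsPoissonPointProcess P (ENNReal.ofReal M.lam • (volume : Measure Plane)) Φ) :
    Integrable (fun s => ∑ᶠ x ∈ Φ s ∩ Metric.closedBall 0 M.fovRadius, M.powerAt ‖x‖) P := by
  have hB : MeasurableSet (Metric.closedBall (0 : Plane) M.fovRadius) :=
    Metric.isClosed_closedBall.measurableSet
  have hBb : Bornology.IsBounded (Metric.closedBall (0 : Plane) M.fovRadius) :=
    Metric.isBounded_closedBall
  refine Integrable.mono' ((hΦ.integrable_toNat_count hB hBb
    (M.intensity_closedBall_ne_top _)).mul_const (M.powerAt 0))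
    (hΦ.measurable_finsum hB hBb (M.measurable_powerAt.comp measurable_norm)).aestronglyMeasurable
    (Eventually.of_forall fun s => ?_)
  have hfin := hΦ.locallyFinite s _ hBb
  rw [Real.norm_of_nonneg (finsum_nonneg fun _ => finsum_nonneg fun _ => (M.powerAt_pos _).le),
    finsum_mem_eq_finite_toFinset_sum _ hfin, hfin.encard_eq_coe_toFinset_card,
    ENat.toNat_natCast, ← nsmul_eq_mul]
  exact Finset.sum_le_card_nsmul _ _ _ fun x _ => M.powerAt_anti le_rfl (norm_nonneg x)

/-- `Ω` has no atoms on the event that the serving OBS is in the field of view. -/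
theorem ae_omegaVar_ne [IsProbabilityMeasure P]
    (hΦ : IsPoissonPointProcess P (ENNReal.ofReal M.lam • (volume : Measure Plane)) Φ) (c : ℝ) :
    ∀ᵐ s ∂P, (M.indoor (Φ s)).Nonempty → M.servingDist (Φ s) ≤ M.fovRadius →
      M.omegaVar (Φ s) ≠ c := by
  filter_upwards [hΦ.ae_max_sub_finsum_ne Metric.isClosed_closedBall.measurableSet
    Metric.isBounded_closedBall (M.intensity_closedBall_ne_top M.fovRadius)
    (M.measurable_powerAt.comp measurable_norm) (M.powerAt_norm_fiber_null _)
    M.targetSINR c] with s hs hne hr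
  have hfin := M.finite_indoor hΦ s
  refine hs _ (M.serving_mem_fov hfin hne hr) fun y hy => ?_
  refine M.powerAt_anti (norm_nonneg _) ((serving_spec hfin hne).2 y ?_)
  rw [← M.indoor_inter_fov] at hy
  exact hy.1

theorem measure_indoor_nonempty_inter_fov_ne_zero [IsProbabilityMeasure P]
    (hΦ : IsPoissonPointProcess P (ENNReal.ofReal M.lam • (volume : Measure Plane)) Φ) :
    P ({s | (M.indoor (Φ s)).Nonempty} ∩ {s | M.servingDist (Φ s) ≤ M.fovRadius}) ≠ 0 := by
  have hsub : {s | (Φ s ∩ Metric.closedBall 0 M.fovRadius).Nonempty} ⊆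
      {s | (M.indoor (Φ s)).Nonempty} ∩ {s | M.servingDist (Φ s) ≤ M.fovRadius} := by
    intro s hs
    obtain ⟨x, hx⟩ : (Φ s ∩ Metric.closedBall 0 M.fovRadius).Nonempty := hs
    rw [← M.indoor_inter_fov] at hx
    have hne : (M.indoor (Φ s)).Nonempty := ⟨x, hx.1⟩
    exact ⟨hne, ((serving_spec (M.finite_indoor hΦ s) hne).2 x hx.1).trans (by simpa using hx.2)⟩
  have h := hΦ.measureReal_nonempty (B := Metric.closedBall 0 M.fovRadius)
    Metric.isClosed_closedBall.measurableSet (M.intensity_closedBall_ne_top _)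
  have hpos := ENNReal.toReal_pos (M.intensity_closedBall_pos M.fovRadius_pos).ne'
    (M.intensity_closedBall_ne_top _)
  intro h0
  have h1 := measure_mono_null hsub h0
  rw [measureReal_def, h1, ENNReal.toReal_zero] at h
  have := Real.exp_lt_one_iff.2 (neg_lt_zero.2 hpos)
  linarith

/-- The exponentials combine to `exp(jwY)`, whose imaginary part over `w` is `Y sinc(wY)`, also
where `Y = 0`. -/
theorem inversionIntegrand_eq {Q : Measure S} [IsFiniteMeasure Q]
    (hQ : Q = (M.prob P Φ)[|{s | M.servingDist (Φ s) ≤ M.fovRadius}]) {Y : S → ℝ}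
    (hY : AEMeasurable Y Q)
    (hYΩ : ∀ᵐ s ∂Q, Y s = M.targetSINR * M.noise - M.omegaVar (Φ s)) {w : ℝ} (hw : w ≠ 0) :
    M.inversionIntegrand P Φ w = ∫ s, Y s * Real.sinc (w * Y s) ∂Q := by
  have h1 : M.charFunOmega P Φ w * Complex.exp (Complex.I * w * (M.targetSINR * M.noise : ℝ)) =
      ∫ s, Complex.exp ((w * Y s : ℝ) * Complex.I) ∂Q := by
    rw [charFunOmega, ← hQ, ← integral_mul_const]
    refine integral_congr_ae ?_
    filter_upwards [hYΩ] with s hs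
    rw [hs, ← Complex.exp_add]
    congr 1
    push_cast
    ring
  have hint : Integrable (fun s => Complex.exp ((w * Y s : ℝ) * Complex.I)) Q := by
    refine Integrable.of_bound (C := 1) ?_ (Eventually.of_forall fun s => ?_)
    · have hc : Continuous fun y : ℝ => Complex.exp ((w * y : ℝ) * Complex.I) := by fun_prop
      exact hc.comp_aestronglyMeasurable hY.aestronglyMeasurable
    · rw [Complex.norm_exp_ofReal_mul_I]
  have h2 := integral_im hint
  rw [inversionIntegrand, h1, ← RCLike.im_eq_complex_im, ← h2, ← integral_div]
  refine integral_congr_ae (Eventually.of_forall fun s => ?_)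
  simp only [RCLike.im_eq_complex_im, Complex.exp_ofReal_mul_I_im]
  by_cases hy : Y s = 0
  · simp [hy]
  · rw [Real.sinc_of_ne_zero (mul_ne_zero hw hy)]
    field_simp

end VLCNetwork

end

/-- The exact coverage probability of the VLC-only network. The integral over `(0, ∞)` is the limit
of the (absolutely convergent) integrals over `(0, A]` as `A → ∞`. -/
theorem lemma4 {S : Type*} [MeasurableSpace S] (P : Measure S) [IsProbabilityMeasure P]
    (M : VLCNetwork) (Φ : S → Set Plane)
    (hΦ : IsPoissonPointProcess P (ENNReal.ofReal M.lam • (volume : Measure Plane)) Φ) :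
    (∀ A : ℝ, 0 < A → IntervalIntegrable (M.inversionIntegrand P Φ) volume 0 A) ∧
    ∃ J : ℝ,
      Tendsto (fun A : ℝ => ∫ w in (0 : ℝ)..A, M.inversionIntegrand P Φ w) atTop (𝓝 J) ∧
      M.coverageProb P Φ = (1 / 2 - 1 / Real.pi * J) * M.probInFov P Φ := by
  set N : Set S := {s | (M.indoor (Φ s)).Nonempty} with hN
  set F : Set S := {s | M.servingDist (Φ s) ≤ M.fovRadius} with hF
  have hNm : MeasurableSet N := M.measurableSet_inter_closedBall_nonempty hΦ M.Rm
  have hrm := M.measurable_servingDist hΦ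
  have hFm : MeasurableSet F := hrm measurableSet_Iic
  have hNF : P (N ∩ F) ≠ 0 := M.measure_indoor_nonempty_inter_fov_ne_zero hΦ
  have hN0 : P N ≠ 0 := fun h => hNF (measure_mono_null inter_subset_left h)
  have hprob : IsProbabilityMeasure (M.prob P Φ) := cond_isProbabilityMeasure hN0
  set Q : Measure S := (M.prob P Φ)[|F] with hQ
  have hQ' : Q = P[|N ∩ F] := cond_cond_eq_cond_inter hNm hFm P
  have hQprob : IsProbabilityMeasure Q := hQ' ▸ cond_isProbabilityMeasure hNF
  have hQae : ∀ᵐ s ∂Q, s ∈ N ∩ F := hQ' ▸ ae_cond_mem (hNm.inter hFm)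
  have hQac : Q ≪ P := hQ' ▸ cond_absolutelyContinuous
  -- A globally measurable and integrable version of `γ̃ B_o f² N_o - Ω`, guaranteed to agree with
  -- it only on `N ∩ F`.
  let Y : S → ℝ := fun s => M.targetSINR * M.noise -
    ((1 + M.targetSINR) * M.powerAt (M.servingDist (Φ s)) -
      M.targetSINR * ∑ᶠ x ∈ Φ s ∩ Metric.closedBall 0 M.fovRadius, M.powerAt ‖x‖)
  have hYΩ : ∀ s ∈ N ∩ F, Y s = M.targetSINR * M.noise - M.omegaVar (Φ s) := fun s hs => by
    rw [M.omegaVar_eq (M.finite_indoor hΦ s) hs.1 hs.2]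
  have hpm : Measurable fun s => M.powerAt (M.servingDist (Φ s)) := M.measurable_powerAt.comp hrm
  have hYm : Measurable Y :=
    ((hpm.const_mul _).sub ((hΦ.measurable_finsum Metric.isClosed_closedBall.measurableSet
      Metric.isBounded_closedBall (M.measurable_powerAt.comp measurable_norm)).const_mul
        _)).const_sub _
  have hpi : Integrable (fun s => M.powerAt (M.servingDist (Φ s))) P := by
    refine Integrable.of_bound (C := M.powerAt 0) hpm.aestronglyMeasurable
      (Eventually.of_forall fun s => ?_)
    rw [Real.norm_of_nonneg (M.powerAt_pos _).le]
    exact M.powerAt_anti le_rfl (norm_nonneg _)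
  have hYP : Integrable Y P := (integrable_const _).sub
    ((hpi.const_mul _).sub ((M.integrable_finsum_powerAt hΦ).const_mul _))
  have hYi : Integrable Y Q := hQ' ▸ integrable_cond hNF hYP
  have hYQ : ∀ᵐ s ∂Q, Y s = M.targetSINR * M.noise - M.omegaVar (Φ s) :=
    hQae.mono hYΩ
  have hY0 : ∀ᵐ s ∂Q, Y s ≠ 0 := by
    filter_upwards [hQac (M.ae_omegaVar_ne hΦ (M.targetSINR * M.noise)), hQae] with s h1 h2 h3
    rw [hYΩ s h2] at h3
    exact h1 h2.1 h2.2 (by linarith)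
  have hinv : ∀ w : ℝ, w ≠ 0 →
      ∫ s, Y s * Real.sinc (w * Y s) ∂Q = M.inversionIntegrand P Φ w := fun w hw =>
    (M.inversionIntegrand_eq hQ hYm.aemeasurable hYQ hw).symm
  refine ⟨fun A hA => ?_,
    Real.pi / 2 * (Q.real {s | 0 < Y s} - Q.real {s | Y s < 0}), ?_, ?_⟩
  · refine ((continuous_integral_mul_sinc hYi).intervalIntegrable 0 A).congr fun w hw => ?_
    rw [uIoc_of_le hA.le] at hw
    exact hinv w hw.1.ne'
  · refine (tendsto_integral_integral_mul_sinc hYi hYm).congr' ?_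
    filter_upwards [eventually_ge_atTop 0] with A hA
    refine intervalIntegral.integral_congr_ae (Eventually.of_forall fun w hw => ?_)
    rw [uIoc_of_le hA] at hw
    exact hinv w hw.1.ne'
  · have hneg : MeasurableSet {s | Y s < 0} := hYm measurableSet_Iio
    have hcompl : Q.real {s | 0 < Y s} = 1 - Q.real {s | Y s < 0} := by
      rw [← probReal_compl_eq_one_sub hneg]
      refine measureReal_congr ?_
      filter_upwards [hY0] with s hs
      refine propext (show 0 < Y s ↔ ¬ Y s < 0 from ?_)
      exact ⟨fun h => h.not_gt, fun h => lt_of_le_of_ne (not_lt.1 h) hs.symm⟩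
    have hcov : M.coverageProb P Φ = (M.prob P Φ).real (F ∩ {s | Y s < 0}) := by
      refine measureReal_congr ?_
      have hNae : ∀ᵐ s ∂(M.prob P Φ), s ∈ N := ae_cond_mem hNm
      filter_upwards [hNae] with s hs
      refine propext (show M.targetSINR < M.sinr (Φ s) ↔ s ∈ F ∧ Y s < 0 from ?_)
      rw [M.targetSINR_lt_sinr_iff (M.finite_indoor hΦ s) hs]
      refine and_congr_right fun h => ?_
      rw [hYΩ s ⟨hs, h⟩, sub_neg]
    have hmul : Q.real {s | Y s < 0} * M.probInFov P Φ = (M.prob P Φ).real (F ∩ {s | Y s < 0}) := by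
      have := cond_mul_eq_inter hFm {s | Y s < 0} (M.prob P Φ)
      rw [measureReal_def (M.prob P Φ), ← this, ENNReal.toReal_mul]
      rfl
    -- With `p = Q(Y < 0)`, the bracket is `1/2 - (1 - 2p)/2 = p`.
    rw [hcov, ← hmul, hcompl]
    congr 1
    field_simp
    ring
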